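/- Let $a,b\ge 1$. A standard Young tableau (SYT) of shape $a\times b$ is a filling $T$ of the boxes of the rectangle with $a$ rows and $b$ columns (rows numbered $1,\dots,a$ from top to bottom) by $1,\dots,ab$, each used once, with entries increasing along rows and down columns. Its descents are the $i$ such that $i+1$ appears in a strictly higher row than $i$, and $\mathrm{comaj}(T)=\sum_{i\text{ descent of }T}(ab-i)$. A barely set-valued SYT of shape $a\times b$ is a filling $S$ of the boxes by nonempty finite sets such that each of $1,\dots,ab+1$ appears in exactly one box and no other number appears, and $\max S(u)<\min S(v)$ whenever $u\ne v$ is weakly northwest of $v$. Exactly one box $u_*(S)$ then contains two numbers; let $r_*(S)\in\{1,\dots,a\}$ be its row and $i_*(S)=\max S(u_*(S))$. The barely set-valued descents of $S$ are the $i\in\{1,\dots,ab+1\}$ such that $i+1$ appears in a strictly higher row than $i$, except that $i_*(S)-1$ is never a descent and $i_*(S)$ always is; put $\mathrm{comaj}^{+1}(S)=\sum_{i}(ab+1-i)$, summed over these descents. Write $[k]_q=1+q+\cdots+q^{k-1}$ and $[k]_{q,t}=t^{k-1}+qt^{k-2}+\cdots+q^{k-2}t+q^{k-1}$. Then $$\sum_{S}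 q^{\mathrm{comaj}^{+1}(S)}\,t^{\,r_*(S)-1}=\frac{[a]_{q,t}\,[b]_q}{[a+b]_q}\cdot[ab+1]_q\cdot\sum_{T} q^{\mathrm{comaj}(T)},$$ where $S$ runs over the barely set-valued SYT and $T$ over the SYT of shape $a\times b$. Here $q,t$ are elements of any field in which $[a+b]_q\neq 0$ (for example the indeterminates of $\mathbb{Q}(q,t)$, or real numbers with $q>0$). -/

import Mathlib

namespace RectTableau

/-- A box of the rectangle with `a` rows and `b` columns, in matrix coordinates counted from `0`
(rows from top to bottom, columns from left to right). In the product order, `u ≤ v` says that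
`u` is weakly northwest of `v`. -/
abbrev Box (a b : ℕ) : Type := Fin a × Fin b

/-- The row of a box, counted from `1` at the top. -/
def row {a b : ℕ} (u : Box a b) : ℕ := (u.1 : ℕ) + 1

/-- `T` is a standard Young tableau of shape `a × b`: each of `1, …, ab` appears exactly once, and
entries increase along rows and down columns. -/
def IsSYT {a b : ℕ} (T : Box a b → ℕ) : Prop :=
  Set.BijOn T Set.univ (Set.Icc 1 (a * b)) ∧
  (∀ i : Fin a, ∀ j j' : Fin b, j < j' → T (i, j) < T (i, j')) ∧
  (∀ i i' : Fin a, ∀ j : Fin b, i < i' → T (i, j) < T (i', j))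

/-- `S` is a standard set-valued tableau of shape `a × b` with entries `1, …, ab + k`: the boxes
hold nonempty finite sets, each of `1, …, ab + k` appears in exactly one box (and nothing else
appears), and `max (S u) < min (S v)` whenever `u ≠ v` is weakly northwest of `v`. -/
def IsSetValuedSYT {a b : ℕ} (k : ℕ) (S : Box a b → Finset ℕ) : Prop :=
  (∀ u, (S u).Nonempty) ∧
  Finset.univ.biUnion S = Finset.Icc 1 (a * b + k) ∧
  (∀ u v, u ≠ v → Disjoint (S u) (S v)) ∧
  (∀ u v, u < v → ∀ x ∈ S u, ∀ y ∈ S v, x < y)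

/-- Barely set-valued: exactly one more number than boxes. -/
def IsBarelySetValuedSYT {a b : ℕ} (S : Box a b → Finset ℕ) : Prop :=
  IsSetValuedSYT 1 S

open Classical in
/-- The finite set of standard Young tableaux of shape `a × b`. -/
noncomputable def SYT (a b : ℕ) : Finset (Box a b → ℕ) :=
  (Fintype.piFinset fun _ => Finset.Icc 1 (a * b)).filter IsSYT

open Classical in
/-- The finite set of standard barely set-valued tableaux of shape `a × b`. -/
noncomputable def BSVSYT (a b : ℕ) : Finset (Box a b → Finset ℕ) :=
  (Fintype.piFinset fun _ => (Finset.Icc 1 (a * b + 1)).powerset).filter IsBarelySetValuedSYT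

theorem mem_SYT {a b : ℕ} {T : Box a b → ℕ} : T ∈ SYT a b ↔ IsSYT T := by
  classical
  simp only [SYT, Finset.mem_filter, Fintype.mem_piFinset, and_iff_right_iff_imp]
  intro h u
  simpa using h.1.mapsTo (Set.mem_univ u)

theorem mem_BSVSYT {a b : ℕ} {S : Box a b → Finset ℕ} :
    S ∈ BSVSYT a b ↔ IsBarelySetValuedSYT S := by
  classical
  simp only [BSVSYT, Finset.mem_filter, Fintype.mem_piFinset, and_iff_right_iff_imp]
  intro h u
  rw [Finset.mem_powerset, ← h.2.1]
  exact Finset.subset_biUnion_of_mem S (Finset.mem_univ u)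

/-- A barely set-valued tableau has exactly one box with two entries; all others have one. -/
theorem existsUnique_doubled {a b : ℕ} {S : Box a b → Finset ℕ} (h : IsBarelySetValuedSYT S) :
    ∃ u, (S u).card = 2 ∧ ∀ v, v ≠ u → (S v).card = 1 := by
  classical
  obtain ⟨hne, hun, hdis, -⟩ := h
  have hcard : ∑ u, (S u).card = a * b + 1 := by
    rw [← Finset.card_biUnion (fun u _ v _ huv => hdis u v huv), hun]; simp
  have hpos : ∀ u, 1 ≤ (S u).card := fun u => (hne u).card_pos
  have hsum : ∑ u, ((S u).card - 1) = 1 := by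
    have h1 : ∑ u, ((S u).card - 1) + ∑ _u : Box a b, 1 = a * b + 1 := by
      rw [← Finset.sum_add_distrib, ← hcard]
      exact Finset.sum_congr rfl fun u _ => Nat.sub_add_cancel (hpos u)
    simp at h1
    omega
  obtain ⟨u, -, hu⟩ := Finset.exists_ne_zero_of_sum_ne_zero (by omega : ∑ u, ((S u).card - 1) ≠ 0)
  rw [← Finset.add_sum_erase _ _ (Finset.mem_univ u)] at hsum
  have h0 : ∑ v ∈ Finset.univ.erase u, ((S v).card - 1) = 0 := by omega
  refine ⟨u, by have := hpos u; omega, fun v hv => ?_⟩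
  have := Finset.sum_eq_zero_iff.1 h0 v (Finset.mem_erase.2 ⟨hv, Finset.mem_univ v⟩)
  have := hpos v
  omega

/-- The set of boxes with two entries; for a barely set-valued tableau it is the singleton of the
doubled box `u_*(S)`. -/
def doubled {a b : ℕ} (S : Box a b → Finset ℕ) : Finset (Box a b) :=
  Finset.univ.filter fun u => (S u).card = 2

theorem doubled_eq_singleton {a b : ℕ} {S : Box a b → Finset ℕ} (h : IsBarelySetValuedSYT S) :
    ∃ u, doubled S = {u} := by
  obtain ⟨u, hu, hv⟩ := existsUnique_doubled h
  refine ⟨u, ?_⟩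
  ext v
  simp only [doubled, Finset.mem_filter, Finset.mem_univ, true_and, Finset.mem_singleton]
  constructor
  · intro h2
    by_contra hne
    have := hv v hne
    omega
  · rintro rfl
    exact hu

/-- `i_*(S)`: the larger entry of the doubled box. (The outer supremum is over one box.) -/
def iStar {a b : ℕ} (S : Box a b → Finset ℕ) : ℕ :=
  (doubled S).sup fun u => (S u).sup id

/-- `r_*(S)`: the row of the doubled box, counted from `1`. (The supremum is over one box.) -/
def rStar {a b : ℕ} (S : Box a b → Finset ℕ) : ℕ :=
  (doubled S).sup row

open Classical in
/-- (Natural) descents of a tableau: the entries `i` such that `i + 1` appears in a strictly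
higher row than `i`. -/
noncomputable def des {a b : ℕ} (T : Box a b → ℕ) : Finset ℕ :=
  (Finset.Icc 1 (a * b)).filter fun i => ∃ u v, T u = i ∧ T v = i + 1 ∧ row v < row u

/-- The (natural) comajor index. -/
noncomputable def comaj {a b : ℕ} (T : Box a b → ℕ) : ℕ :=
  ∑ i ∈ des T, (a * b - i)

open Classical in
/-- Barely set-valued descents: the `i` in `1, …, ab + 1` such that `i + 1` appears in a strictly
higher row than `i`, except that `i_* - 1` is never and `i_*` is always a descent. -/
noncomputable def desPlus {a b : ℕ} (S : Box a b → Finset ℕ) : Finset ℕ :=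
  (Finset.Icc 1 (a * b + 1)).filter fun i =>
    i + 1 ≠ iStar S ∧
      (i = iStar S ∨ ∃ u v, i ∈ S u ∧ i + 1 ∈ S v ∧ row v < row u)

/-- The barely set-valued comajor index. -/
noncomputable def comajPlus {a b : ℕ} (S : Box a b → Finset ℕ) : ℕ :=
  ∑ i ∈ desPlus S, (a * b + 1 - i)

/-- `[k]_q = 1 + q + ⋯ + q^(k-1)`. -/
def qNum {K : Type*} [Field K] (q : K) (k : ℕ) : K :=
  ∑ i ∈ Finset.range k, q ^ i

/-- `[k]_{q,t} = t^(k-1) + q t^(k-2) + ⋯ + q^(k-1)`. -/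
def qtNum {K : Type*} [Field K] (q t : K) (k : ℕ) : K :=
  ∑ i ∈ Finset.range k, q ^ i * t ^ (k - 1 - i)

end RectTableau

/-!
The proof compares weighted counts. Consider pairs of a weakly increasing filling `π` of the rectangle by
natural numbers and a threshold `k : ℕ`, weighted by `q ^ (|π| + k)`, and look at the lower set
`I = {π ≤ k}`. Write `levelGF q Q` for the total weight of the pairs for which `I` has property `Q`.

* *From tableaux to fillings.* By the theory of `P`-partitions (`tsum_sort`, from stable sorting),
  the total weight of the pairs for which `p` is a maximal ("removable") box of `I` is, up to the
  factor `1 / ((1 - q) ⋯ (1 - q ^ (ab + 1)))`, the generating function by `comajPlus` of the barely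
  set-valued tableaux doubled at `p` (`levelGF_maximal`): the larger entry of the doubled box plays
  the role of an extra element of the poset with the largest label, which is why a descent never
  ends and always starts there. The total weight of all pairs gives the standard tableaux
  (`levelGF_true`).
* *Toggling.* Exchanging `k` and `π p`, up to a shift by one, shows that `p` is a minimal box of the
  complement ("addable") with `q` times the weight with which it is removable (`levelGF_minimal`).
* *Rows and columns.* A lower set has a removable box in a row exactly if it has an addable box in
  the next one. So if `e i` is the weight of having a removable box in row `i`, then
  `e i = q * e (i + 1)`; likewise `f j = q * f (j + 1)` for columns. Moreover the last column has a
  removable box exactly if the first row has no addable one, so `q * e 0 + f (b - 1)` is the total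
  weight, and `∑ i, e i = ∑ j, f j`. These relations determine every `e i`
  (`geom_mul_sum_levelGF_row`).

All sums are taken in `ℝ≥0∞`, for a real parameter `0 ≤ q < 1`, where no convergence question
arises. The resulting identity is one between polynomials with natural coefficients, hence it holds
in every field.
-/

open scoped ENNReal

namespace RectTableau

/-! ### Generating functions of sorted sequences -/

/-- `∏_{i=1}^n (1 - q^i)⁻¹`, the generating function of weakly increasing sequences of length `n`
of natural numbers. -/
noncomputable def chainGF (q : ℝ≥0∞) (n : ℕ) : ℝ≥0∞ :=
  ∏ i ∈ Finset.range n, (1 - q ^ (i + 1))⁻¹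

/-- Sequences of length `n` whose `i`-th step is at least `δ i`. -/
def Gapped (n : ℕ) (δ : ℕ → ℕ) (s : Fin n → ℕ) : Prop :=
  ∀ (i : ℕ) (h : i + 1 < n), s ⟨i, by omega⟩ + δ i ≤ s ⟨i + 1, h⟩

theorem Gapped.first_add_le {n : ℕ} {δ : ℕ → ℕ} {s : Fin (n + 1) → ℕ} (hs : Gapped (n + 1) δ s)
    (i : Fin n) : s 0 + δ 0 ≤ s i.succ := by
  obtain ⟨i, hi⟩ := i
  induction i with
  | zero => exact hs 0 (by omega)
  | succ i ih =>
    have h1 := ih (by omega)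
    have h2 := hs (i + 1) (by omega)
    simp only [Fin.succ_mk] at h1 ⊢
    omega

/-- A gapped sequence is its first entry together with the remaining entries, shifted down so that
the first gap becomes void. -/
def gappedEquiv (n : ℕ) (δ : ℕ → ℕ) :
    {s : Fin (n + 1) → ℕ // Gapped (n + 1) δ s} ≃
      ℕ × {s : Fin n → ℕ // Gapped n (fun i => δ (i + 1)) s} where
  toFun s := (s.1 0, ⟨fun i => s.1 i.succ - (s.1 0 + δ 0), fun i h => by
    have h1 := s.2 (i + 1) (by omega)
    have h2 := s.2.first_add_le ⟨i, by omega⟩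
    simp only [Fin.succ_mk] at h1 h2 ⊢
    omega⟩)
  invFun p := ⟨Fin.cons p.1 fun i => p.2.1 i + (p.1 + δ 0), fun i h => by
    cases i with
    | zero =>
      have e : (⟨0 + 1, h⟩ : Fin (n + 1)) = Fin.succ ⟨0, by omega⟩ := rfl
      have e0 : (⟨0, by omega⟩ : Fin (n + 1)) = 0 := rfl
      rw [e, e0, Fin.cons_succ, Fin.cons_zero]
      omega
    | succ i =>
      have e : (⟨i + 1 + 1, h⟩ : Fin (n + 1)) = Fin.succ ⟨i + 1, by omega⟩ := rfl
      have e0 : (⟨i + 1, by omega⟩ : Fin (n + 1)) = Fin.succ ⟨i, by omega⟩ := rfl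
      rw [e, e0, Fin.cons_succ, Fin.cons_succ]
      have := p.2.2 i (by omega)
      simp only at this
      omega⟩
  left_inv s := by
    ext i
    refine Fin.cases ?_ (fun i => ?_) i
    · simp
    · have := s.2.first_add_le i
      simp only [Fin.cons_succ]
      omega
  right_inv p := by
    ext <;> simp

theorem tsum_gapped (q : ℝ≥0∞) (n : ℕ) (δ : ℕ → ℕ) :
    ∑' s : {s : Fin n → ℕ // Gapped n δ s}, q ^ (∑ i, s.1 i) =
      chainGF q n * q ^ (∑ i ∈ Finset.range n, δ i * (n - 1 - i)) := by
  induction n generalizing δ with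
  | zero =>
    have : Unique {s : Fin 0 → ℕ // Gapped 0 δ s} :=
      { default := ⟨Fin.elim0, fun i h => by omega⟩
        uniq := fun s => Subtype.ext (Subsingleton.elim _ _) }
    rw [tsum_fintype, Fintype.sum_unique]
    simp [chainGF]
  | succ n ih =>
    have key : ∀ p, q ^ (∑ i, ((gappedEquiv n δ).symm p).1 i) =
        q ^ (δ 0 * n) * ((q ^ (n + 1)) ^ p.1 * q ^ (∑ i, p.2.1 i)) := by
      intro p
      rw [← pow_mul, ← pow_add, ← pow_add]
      congr 1
      simp only [gappedEquiv, Equiv.coe_fn_symm_mk, Fin.sum_univ_succ, Fin.cons_zero,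
        Fin.cons_succ, Finset.sum_add_distrib, Finset.sum_const, Finset.card_univ,
        Fintype.card_fin, smul_eq_mul]
      ring
    rw [← (gappedEquiv n δ).symm.tsum_eq]
    simp_rw [key]
    rw [ENNReal.tsum_mul_left, ENNReal.tsum_prod']
    simp only [ENNReal.tsum_mul_left, ih, ENNReal.tsum_mul_right]
    rw [ENNReal.tsum_geometric, chainGF, chainGF, Finset.prod_range_succ,
      Finset.sum_range_succ' _ n, pow_add]
    have : ∀ i, n + 1 - 1 - (i + 1) = n - 1 - i := fun i => by omega
    simp_rw [this]
    simp only [Nat.add_sub_cancel, Nat.sub_zero]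
    ring

theorem chainGF_succ (q : ℝ≥0∞) (n : ℕ) :
    chainGF q (n + 1) = chainGF q n * (1 - q ^ (n + 1))⁻¹ :=
  Finset.prod_range_succ _ _

theorem chainGF_ne_zero (q : ℝ≥0∞) (n : ℕ) : chainGF q n ≠ 0 := by
  rw [chainGF, Finset.prod_ne_zero_iff]
  intro i _
  exact ENNReal.inv_ne_zero.2 (ENNReal.sub_ne_top ENNReal.one_ne_top)

theorem chainGF_ne_top {q : ℝ≥0∞} (hq : q < 1) (n : ℕ) : chainGF q n ≠ ⊤ := by
  rw [chainGF]
  refine ENNReal.prod_ne_top fun i _ => ENNReal.inv_ne_top.2 ?_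
  exact (tsub_pos_of_lt (pow_lt_one₀ zero_le hq (by omega))).ne'

/-! ### Sorting permutations -/

/-- Descents, as an indicator function on positions `0, 1, …`, of a permutation `e` read as the
word `e 0, e 1, …`. -/
def permDes {n : ℕ} (e : Equiv.Perm (Fin n)) (i : ℕ) : ℕ :=
  if h : i + 1 < n then if e ⟨i + 1, h⟩ < e ⟨i, by omega⟩ then 1 else 0 else 0

/-- The comajor index of a permutation; the descent at position `i`, counted from `0`, has weight
`n - 1 - i`. -/
def permComaj {n : ℕ} (e : Equiv.Perm (Fin n)) : ℕ :=
  ∑ i ∈ Finset.range n, permDes e i * (n - 1 - i)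

theorem sort_eq_iff_gapped {n : ℕ} (f : Fin n → ℕ) (e : Equiv.Perm (Fin n)) :
    Tuple.sort f = e ↔ Gapped n (permDes e) (f ∘ e) := by
  have h1 : Tuple.sort f = e ↔ StrictMono fun i => toLex (f (e i), e i) := by
    rw [eq_comm, Tuple.eq_sort_iff]
    constructor
    · rintro ⟨hm, ht⟩ i j hij
      rw [Prod.Lex.toLex_lt_toLex]
      rcases (hm hij.le).lt_or_eq with h | h
      · exact Or.inl h
      · exact Or.inr ⟨h, ht i j hij h⟩
    · intro h
      refine ⟨fun i j hij => ?_, fun i j hij he => ?_⟩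
      · have := h.monotone hij
        rw [Prod.Lex.toLex_le_toLex] at this
        rcases this with h | h
        · exact h.le
        · exact h.1.le
      · have := h hij
        rw [Prod.Lex.toLex_lt_toLex] at this
        rcases this with h | h
        · exact absurd he h.ne
        · exact h.2
  rw [h1]
  cases n with
  | zero => exact iff_of_true (fun i => i.elim0) fun i h => by omega
  | succ n =>
    rw [Fin.strictMono_iff_lt_succ]
    constructor
    · intro h i hi
      have := h ⟨i, by omega⟩
      rw [Prod.Lex.toLex_lt_toLex] at this
      simp only [Fin.castSucc_mk, Fin.succ_mk] at this
      simp only [permDes, hi, dif_pos, Function.comp]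
      split_ifs with hd
      · rcases this with h | h
        · omega
        · exact absurd hd h.2.asymm
      · rcases this with h | h <;> omega
    · rintro h ⟨i, hi⟩
      have := h i (by omega)
      rw [Prod.Lex.toLex_lt_toLex]
      simp only [permDes, dif_pos (show i + 1 < n + 1 by omega), Function.comp] at this
      simp only [Fin.castSucc_mk, Fin.succ_mk]
      split_ifs at this with hd
      · left; omega
      · rcases (Nat.le_of_add_right_le this).lt_or_eq with h' | h'
        · exact Or.inl h'
        · refine Or.inr ⟨h', lt_of_le_of_ne (not_lt.1 hd) fun he => ?_⟩
          have := congrArg Fin.val (e.injective he)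
          simp at this

/-- The order in which stable sorting lists two indices: by value, ties broken by index. -/
theorem sort_symm_lt_iff {n : ℕ} (f : Fin n → ℕ) (x y : Fin n) :
    (Tuple.sort f).symm x < (Tuple.sort f).symm y ↔ f x < f y ∨ f x = f y ∧ x < y := by
  have key : ∀ x y, (Tuple.sort f).symm x < (Tuple.sort f).symm y →
      f x < f y ∨ f x = f y ∧ x < y := by
    intro x y h
    obtain ⟨hm, ht⟩ := (Tuple.eq_sort_iff (f := f) (σ := Tuple.sort f)).1 rfl
    have h1 := hm h.le
    simp only [Function.comp, Equiv.apply_symm_apply] at h1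
    rcases h1.lt_or_eq with h2 | h2
    · exact Or.inl h2
    · refine Or.inr ⟨h2, ?_⟩
      have := ht _ _ h (by simpa using h2)
      simpa using this
  refine ⟨key x y, fun h => ?_⟩
  by_contra hn
  rcases (not_lt.1 hn).lt_or_eq with h' | h'
  · have := key y x h'
    omega
  · have := (Tuple.sort f).symm.injective h'
    subst this
    omega

open Classical in
/-- The fundamental lemma of `P`-partitions: functions sorted by `e` have generating function
`q ^ comaj e / ((1 - q) ⋯ (1 - q ^ n))`, so any condition on a function that only depends on its
sorting permutation can be transferred to permutations weighted by `comaj`. -/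
theorem tsum_sort (q : ℝ≥0∞) (n : ℕ) (Q : Equiv.Perm (Fin n) → Prop) :
    ∑' f : Fin n → ℕ, (if Q (Tuple.sort f) then q ^ (∑ i, f i) else 0) =
      chainGF q n * ∑ e with Q e, q ^ permComaj e := by
  have h1 : ∀ f : Fin n → ℕ, (if Q (Tuple.sort f) then q ^ (∑ i, f i) else 0) =
      ∑ e with Q e, if Tuple.sort f = e then q ^ (∑ i, f i) else 0 := by
    intro f
    rw [Finset.sum_ite_eq]
    simp
  simp_rw [h1]
  rw [Summable.tsum_finsetSum (fun _ _ => ENNReal.summable), Finset.mul_sum]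
  refine Finset.sum_congr rfl fun e _ => ?_
  rw [permComaj, ← tsum_gapped, ← (Equiv.arrowCongr e (Equiv.refl ℕ)).tsum_eq]
  have h2 : ∀ s : Fin n → ℕ, (if Tuple.sort (e.arrowCongr (Equiv.refl ℕ) s) = e then
      q ^ (∑ i, e.arrowCongr (Equiv.refl ℕ) s i) else 0) =
      Set.indicator {s | Gapped n (permDes e) s} (fun s => q ^ (∑ i, s i)) s := by
    intro s
    have h3 : e.arrowCongr (Equiv.refl ℕ) s ∘ e = s := by
      ext i; simp [Equiv.arrowCongr]
    simp only [sort_eq_iff_gapped, h3, Set.indicator_apply, Set.mem_ofPred_eq]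
    rw [← Equiv.sum_comp e]
    simp [Equiv.arrowCongr]
  simp_rw [h2]
  rw [← tsum_subtype]
  rfl

/-! ### Corners of lower sets in a rectangle -/

/-- A lower set of the rectangle is given by its row lengths. -/
theorem exists_rowLength {a b : ℕ} {I : Set (Box a b)} (hI : IsLowerSet I) :
    ∃ l : Fin a → ℕ, (∀ i, l i ≤ b) ∧ Antitone l ∧ ∀ i (j : Fin b), (i, j) ∈ I ↔ (j : ℕ) < l i := by
  classical
  have hex : ∀ i : Fin a, ∃ m : ℕ, ∀ j : Fin b, m ≤ j → (i, j) ∉ I := fun i =>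
    ⟨b, fun j hj => absurd j.2 (by omega)⟩
  refine ⟨fun i => Nat.find (hex i), fun i => ?_, fun i i' hi => ?_, fun i j => ⟨?_, ?_⟩⟩
  · exact Nat.find_min' _ fun j hj => absurd j.2 (by omega)
  · refine Nat.find_min' _ fun j hj hmem => ?_
    exact Nat.find_spec (hex i) j hj (hI (show (i, j) ≤ (i', j) from ⟨hi, le_rfl⟩) hmem)
  · intro hmem
    by_contra hn
    exact Nat.find_spec (hex i) j (not_lt.1 hn) hmem
  · intro hlt
    have := Nat.find_min (hex i) hlt
    push Not at this
    obtain ⟨j', hj, hmem⟩ := this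
    exact hI (show (i, j) ≤ (i, j') from ⟨le_rfl, hj⟩) hmem

theorem sum_ite_of_iff {M : Type*} [AddCommMonoid M] {b m : ℕ} {P : Fin b → Prop}
    [DecidablePred P] {C : Prop} [Decidable C] (h : ∀ j, P j ↔ (j : ℕ) = m ∧ C) (hm : C → m < b)
    (w : M) : ∑ j, (if P j then w else 0) = if C then w else 0 := by
  by_cases hC : C
  · rw [Finset.sum_eq_single_of_mem ⟨m, hm hC⟩ (Finset.mem_univ _)]
    · simp [h, hC]
    · intro j _ hj
      have : ¬ P j := fun hP => hj (Fin.ext ((h j).1 hP).1)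
      simp [this]
  · simp [h, hC]

theorem maximal_mem_iff_rowLength {a b : ℕ} {I : Set (Box a b)} {l : Fin a → ℕ}
    (hl : ∀ i (j : Fin b), (i, j) ∈ I ↔ (j : ℕ) < l i) (hb : ∀ i, l i ≤ b) (i : Fin a)
    (j : Fin b) : Maximal (· ∈ I) (i, j) ↔ (j : ℕ) + 1 = l i ∧ ∀ i', i < i' → l i' ≤ j := by
  rw [maximal_iff_forall_gt]
  constructor
  · rintro ⟨h1, h2⟩
    rw [hl] at h1
    refine ⟨?_, fun i' hi' => ?_⟩
    · by_contra hne
      have := hb i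
      refine h2 (y := (i, ⟨j + 1, by omega⟩)) ?_ ((hl _ _).2 ?_)
      · exact Prod.mk_lt_mk_iff_right.2 (Fin.lt_def.2 (by simp))
      · simp only; omega
    · by_contra hn
      exact h2 (y := (i', j)) (Prod.mk_lt_mk_iff_left.2 hi') ((hl _ _).2 (by omega))
  · rintro ⟨h1, h2⟩
    refine ⟨(hl _ _).2 (by omega), ?_⟩
    rintro ⟨i', j'⟩ hlt hmem
    rw [hl] at hmem
    obtain ⟨hi, hj⟩ := Prod.mk_le_mk.1 hlt.le
    rcases hi.lt_or_eq with h | h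
    · have := h2 i' h
      have : (j : ℕ) ≤ j' := hj
      omega
    · subst h
      have := Fin.lt_def.1 (Prod.mk_lt_mk_iff_right.1 hlt)
      omega

theorem minimal_notMem_iff_rowLength {a b : ℕ} {I : Set (Box a b)} {l : Fin a → ℕ}
    (hl : ∀ i (j : Fin b), (i, j) ∈ I ↔ (j : ℕ) < l i) (i : Fin a)
    (j : Fin b) : Minimal (· ∉ I) (i, j) ↔ (j : ℕ) = l i ∧ ∀ i', i' < i → (j : ℕ) < l i' := by
  rw [minimal_iff_forall_lt]
  simp only [not_not]
  constructor
  · rintro ⟨h1, h2⟩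
    rw [hl] at h1
    refine ⟨?_, fun i' hi' => ?_⟩
    · by_contra hne
      have := (hl i ⟨l i, by omega⟩).1 (h2 (y := (i, ⟨l i, by omega⟩)) ?_)
      · simp at this
      · exact Prod.mk_lt_mk_iff_right.2 (Fin.lt_def.2 (by simp only; omega))
    · exact (hl _ _).1 (h2 (y := (i', j)) (Prod.mk_lt_mk_iff_left.2 hi'))
  · rintro ⟨h1, h2⟩
    refine ⟨fun h => ?_, ?_⟩
    · have := (hl _ _).1 h
      omega
    rintro ⟨i', j'⟩ hlt
    rw [hl]
    obtain ⟨hi, hj⟩ := Prod.mk_le_mk.1 hlt.le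
    rcases hi.lt_or_eq with h | h
    · have := h2 i' h
      have : (j' : ℕ) ≤ j := hj
      omega
    · subst h
      have := Fin.lt_def.1 (Prod.mk_lt_mk_iff_right.1 hlt)
      omega

open Classical in
/-- A lower set has a removable box in a row exactly if it has an addable box in the next row: both
say that the next row is strictly shorter. -/
theorem sum_maximal_row_eq_sum_minimal_row {M : Type*} [AddCommMonoid M] {a b : ℕ}
    {I : Set (Box a b)} (hI : IsLowerSet I) (w : M) {i i' : Fin a} (hi : (i' : ℕ) = i + 1) :
    ∑ j, (if Maximal (· ∈ I) (i, j) then w else 0) =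
      ∑ j, (if Minimal (· ∉ I) (i', j) then w else 0) := by
  obtain ⟨l, hb, hanti, hl⟩ := exists_rowLength hI
  have h1 : l i' ≤ l i := hanti (Fin.le_def.2 (by omega))
  have h2 := hb i
  rw [sum_ite_of_iff (m := l i - 1) (C := l i' < l i) _ (by omega),
    sum_ite_of_iff (m := l i') (C := l i' < l i) _ (by omega)]
  · intro j
    rw [minimal_notMem_iff_rowLength hl]
    refine and_congr_right fun hj => ⟨fun h => ?_, fun h r hr => ?_⟩
    · have := h i (Fin.lt_def.2 (by omega)); omega
    · have := hanti (show r ≤ i from Fin.le_def.2 (by have := Fin.lt_def.1 hr; omega)); omega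
  · intro j
    rw [maximal_mem_iff_rowLength hl hb]
    constructor
    · rintro ⟨h, h'⟩
      have := h' i' (Fin.lt_def.2 (by omega))
      omega
    · rintro ⟨h, h'⟩
      refine ⟨by omega, fun r hr => ?_⟩
      have := hanti (show i' ≤ r from Fin.le_def.2 (by have := Fin.lt_def.1 hr; omega))
      omega

open Classical in
theorem sum_minimal_firstRow {M : Type*} [AddCommMonoid M] {a b : ℕ}
    {I : Set (Box (a + 1) (b + 1))} (hI : IsLowerSet I) (w : M) :
    ∑ j, (if Minimal (· ∉ I) (0, j) then w else 0) = if (0, Fin.last b) ∉ I then w else 0 := by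
  obtain ⟨l, hb, hanti, hl⟩ := exists_rowLength hI
  rw [sum_ite_of_iff (m := l 0) (C := (0, Fin.last b) ∉ I) (fun j => ?_) fun h => ?_]
  · rw [minimal_notMem_iff_rowLength hl, hl]
    refine and_congr_right fun hj => iff_of_true (fun r hr => absurd hr (Fin.not_lt_zero r)) ?_
    have := j.2
    simp only [Fin.val_last]
    omega
  · rw [hl, Fin.val_last] at h
    omega

open Classical in
theorem sum_maximal_lastRow {M : Type*} [AddCommMonoid M] {a b : ℕ}
    {I : Set (Box (a + 1) (b + 1))} (hI : IsLowerSet I) (w : M) :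
    ∑ j, (if Maximal (· ∈ I) (Fin.last a, j) then w else 0) =
      if (Fin.last a, 0) ∈ I then w else 0 := by
  obtain ⟨l, hb, hanti, hl⟩ := exists_rowLength hI
  have := hb (Fin.last a)
  rw [sum_ite_of_iff (m := l (Fin.last a) - 1) (C := (Fin.last a, 0) ∈ I) (fun j => ?_) fun h => ?_]
  · rw [maximal_mem_iff_rowLength hl hb, hl, Fin.val_zero]
    constructor
    · rintro ⟨h, -⟩
      omega
    · rintro ⟨h, h'⟩
      exact ⟨by omega, fun r hr => absurd hr (Fin.le_last r).not_gt⟩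
  · rw [hl, Fin.val_zero] at h
    omega

theorem isLowerSet_preimage_swap {a b : ℕ} {I : Set (Box a b)} (hI : IsLowerSet I) :
    IsLowerSet (Prod.swap ⁻¹' I : Set (Box b a)) :=
  hI.preimage fun _ _ h => Prod.swap_le_swap.2 h

theorem maximal_preimage_swap {a b : ℕ} {I : Set (Box a b)} (i : Fin a) (j : Fin b) :
    Maximal (· ∈ (Prod.swap ⁻¹' I : Set (Box b a))) (j, i) ↔ Maximal (· ∈ I) (i, j) := by
  simp only [maximal_iff_forall_gt, Set.mem_preimage, Prod.swap_prod_mk]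
  refine and_congr_right fun _ => ⟨fun h v hv => ?_, fun h v hv => h (Prod.swap_lt_swap.2 hv)⟩
  have := h (y := v.swap) (Prod.swap_lt_swap.2 hv)
  simpa using this

theorem minimal_preimage_swap {a b : ℕ} {I : Set (Box a b)} (i : Fin a) (j : Fin b) :
    Minimal (· ∉ (Prod.swap ⁻¹' I : Set (Box b a))) (j, i) ↔ Minimal (· ∉ I) (i, j) := by
  simp only [minimal_iff_forall_lt, Set.mem_preimage, Prod.swap_prod_mk]
  refine and_congr_right fun _ => ⟨fun h v hv => ?_, fun h v hv => h (Prod.swap_lt_swap.2 hv)⟩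
  have := h (y := v.swap) (Prod.swap_lt_swap.2 hv)
  simpa using this

/-! ### Toggling -/

/-- The boxes with entry at most `k`. -/
def level {a b : ℕ} (π : Box a b → ℕ) (k : ℕ) : Set (Box a b) := {u | π u ≤ k}

theorem isLowerSet_level {a b : ℕ} {π : Box a b → ℕ} (hπ : Monotone π) (k : ℕ) :
    IsLowerSet (level π k) :=
  fun _ _ h hu => (hπ h).trans hu

open Classical in
/-- The generating function, by total size, of pairs of an increasing filling `π` and a threshold
`k` whose level set `{π ≤ k}` has the property `Q`. -/
noncomputable def levelGF (q : ℝ≥0∞) {a b : ℕ} (Q : Set (Box a b) → Prop) : ℝ≥0∞ :=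
  ∑' x : ℕ × (Box a b → ℕ),
    if Monotone x.2 ∧ Q (level x.2 x.1) then q ^ (x.1 + ∑ u, x.2 u) else 0

theorem levelGF_eq_tsum_subtype (q : ℝ≥0∞) {a b : ℕ} (Q : Set (Box a b) → Prop) :
    levelGF q Q = ∑' x : {x : ℕ × (Box a b → ℕ) // Monotone x.2 ∧ Q (level x.2 x.1)},
      q ^ (x.1.1 + ∑ u, x.1.2 u) := by
  classical
  refine Eq.trans (tsum_congr fun x => ?_)
    (tsum_subtype {x : ℕ × (Box a b → ℕ) | Monotone x.2 ∧ Q (level x.2 x.1)}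
      fun x => q ^ (x.1 + ∑ u, x.2 u)).symm
  simp only [Set.indicator_apply, Set.mem_ofPred_eq]

theorem monotone_update {α : Type*} [PartialOrder α] [DecidableEq α] {π : α → ℕ}
    (hπ : Monotone π) (p : α) (m : ℕ) (h1 : ∀ v, v < p → π v ≤ m) (h2 : ∀ v, p < v → m ≤ π v) :
    Monotone (Function.update π p m) := by
  intro u v huv
  rcases eq_or_ne u p with rfl | hu
  · rcases eq_or_ne v u with rfl | hv
    · rfl
    · simpa [hv] using h2 v (lt_of_le_of_ne huv hv.symm)
  · rcases eq_or_ne v p with rfl | hv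
    · simpa [hu] using h1 u (lt_of_le_of_ne huv hu)
    · simpa [hu, hv] using hπ huv

/-- The toggle at `p`: the entry of `p` and the threshold change places, with a shift by one that
turns `π p ≤ k` into `k < π p`. -/
def toggleEquiv {a b : ℕ} (p : Box a b) :
    {x : ℕ × (Box a b → ℕ) // Monotone x.2 ∧ Maximal (· ∈ level x.2 x.1) p} ≃
      {x : ℕ × (Box a b → ℕ) // Monotone x.2 ∧ Minimal (· ∉ level x.2 x.1) p} where
  toFun x := ⟨(x.1.2 p, Function.update x.1.2 p (x.1.1 + 1)), by
    obtain ⟨⟨k, π⟩, hπ, hp⟩ := x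
    simp only [maximal_iff_forall_gt, minimal_iff_forall_lt, level, Set.mem_ofPred_eq,
      not_le, not_lt] at hπ hp ⊢
    refine ⟨monotone_update hπ _ _ (fun v hv => ?_) fun v hv => hp.2 hv, ?_, fun v hv => ?_⟩
    · exact (hπ hv.le).trans (hp.1.trans (Nat.le_succ k))
    · simpa using Nat.lt_succ_of_le hp.1
    · simpa [hv.ne] using hπ hv.le⟩
  invFun x := ⟨(x.1.2 p - 1, Function.update x.1.2 p x.1.1), by
    obtain ⟨⟨k, π⟩, hπ, hp⟩ := x
    simp only [maximal_iff_forall_gt, minimal_iff_forall_lt, level, Set.mem_ofPred_eq,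
      not_le, not_lt] at hπ hp ⊢
    refine ⟨monotone_update hπ _ _ (fun v hv => hp.2 hv) fun v hv => ?_, ?_, fun v hv => ?_⟩
    · exact hp.1.le.trans (hπ hv.le)
    · simp only [Function.update_self]
      omega
    · have := hπ hv.le
      simp only [Function.update_of_ne hv.ne']
      omega⟩
  left_inv x := by simp
  right_inv x := by
    obtain ⟨⟨k, π⟩, hπ, hp⟩ := x
    have h : π p - 1 + 1 = π p := by
      have := hp.1
      simp only [level, Set.mem_ofPred_eq, not_le] at this
      omega
    simp [h]

/-- Toggle symmetry: being addable is `q` times as likely as being removable. -/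
theorem levelGF_minimal (q : ℝ≥0∞) {a b : ℕ} (p : Box a b) :
    levelGF q (fun I => Minimal (· ∉ I) p) = q * levelGF q fun I => Maximal (· ∈ I) p := by
  rw [levelGF_eq_tsum_subtype, levelGF_eq_tsum_subtype, ← (toggleEquiv p).tsum_eq,
    ← ENNReal.tsum_mul_left]
  refine tsum_congr fun x => ?_
  rw [← pow_succ']
  congr 1
  simp only [toggleEquiv, Equiv.coe_fn_mk]
  rw [Finset.sum_update_of_mem (Finset.mem_univ p),
    ← Finset.add_sum_erase _ x.1.2 (Finset.mem_univ p), Finset.sdiff_singleton_eq_erase]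
  omega

theorem sum_levelGF_congr (q : ℝ≥0∞) {a b : ℕ} {ι κ : Type*} [Fintype ι] [Fintype κ]
    (Q : ι → Set (Box a b) → Prop) (R : κ → Set (Box a b) → Prop)
    (h : ∀ I, IsLowerSet I → ∀ w : ℝ≥0∞, (open Classical in ∑ j, (if Q j I then w else 0)) =
      (open Classical in ∑ j, (if R j I then w else 0))) :
    ∑ j, levelGF q (Q j) = ∑ j, levelGF q (R j) := by
  classical
  simp only [levelGF]
  rw [← Summable.tsum_finsetSum (fun _ _ => ENNReal.summable),
    ← Summable.tsum_finsetSum (fun _ _ => ENNReal.summable)]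
  refine tsum_congr fun x => ?_
  by_cases hx : Monotone x.2
  · simp only [hx, true_and]
    convert h _ (isLowerSet_level hx x.1) _
  · simp [hx]

theorem sum_levelGF_row (q : ℝ≥0∞) {a b : ℕ} {i i' : Fin a} (hi : (i' : ℕ) = i + 1) :
    ∑ j : Fin b, levelGF q (fun I => Maximal (· ∈ I) (i, j)) =
      q * ∑ j : Fin b, levelGF q (fun I => Maximal (· ∈ I) (i', j)) := by
  classical
  simp_rw [Finset.mul_sum, ← levelGF_minimal]
  exact sum_levelGF_congr q _ _ fun I hI w => sum_maximal_row_eq_sum_minimal_row hI w hi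

theorem sum_levelGF_column (q : ℝ≥0∞) {a b : ℕ} {j j' : Fin b} (hj : (j' : ℕ) = j + 1) :
    ∑ i : Fin a, levelGF q (fun I => Maximal (· ∈ I) (i, j)) =
      q * ∑ i : Fin a, levelGF q (fun I => Maximal (· ∈ I) (i, j')) := by
  classical
  simp_rw [Finset.mul_sum, ← levelGF_minimal]
  refine sum_levelGF_congr q _ _ fun I hI w => ?_
  have := sum_maximal_row_eq_sum_minimal_row (isLowerSet_preimage_swap hI) w hj
  exact (Finset.sum_congr rfl fun i _ => if_congr (maximal_preimage_swap (I := I) i j).symm rfl rfl).trans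
    (this.trans (Finset.sum_congr rfl fun i _ => if_congr (minimal_preimage_swap i j') rfl rfl))

/-- The last column has a removable box exactly if the first row is full, that is, has no addable
box. -/
theorem firstRow_add_lastColumn (q : ℝ≥0∞) (a b : ℕ) :
    q * ∑ j : Fin (b + 1), levelGF q (fun I : Set (Box (a + 1) (b + 1)) => Maximal (· ∈ I) (0, j)) +
      ∑ i : Fin (a + 1), levelGF q (fun I : Set (Box (a + 1) (b + 1)) =>
        Maximal (· ∈ I) (i, Fin.last b)) =
      levelGF q fun _ : Set (Box (a + 1) (b + 1)) => True := by
  classical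
  simp_rw [Finset.mul_sum, ← levelGF_minimal]
  have h := sum_levelGF_congr (ι := Fin (b + 1) ⊕ Fin (a + 1)) (κ := Unit) q
    (Sum.elim (fun j (I : Set (Box (a + 1) (b + 1))) => Minimal (· ∉ I) (0, j))
      fun i I => Maximal (· ∈ I) (i, Fin.last b)) (fun _ _ => True) ?_
  · simpa only [Fintype.sum_sum_type, Sum.elim_inl, Sum.elim_inr, Fintype.sum_unique] using h
  intro I hI w
  have := (Finset.sum_congr rfl fun i _ => if_congr
    (maximal_preimage_swap (I := I) i (Fin.last b)).symm rfl rfl).trans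
    (sum_maximal_lastRow (isLowerSet_preimage_swap hI) w)
  simp only [Set.mem_preimage, Prod.swap_prod_mk] at this
  have h : ((if (0, Fin.last b) ∉ I then w else 0) + if (0, Fin.last b) ∈ I then w else 0) = w := by
    split_ifs <;> simp_all
  simp only [Fintype.sum_sum_type, Sum.elim_inl, Sum.elim_inr, if_true, Fintype.sum_unique]
  refine Eq.trans ?_ h
  rw [← sum_minimal_firstRow hI, ← this]
  congr!

theorem eq_pow_mul_last {n : ℕ} (q : ℝ≥0∞) {e : Fin (n + 1) → ℝ≥0∞}
    (h : ∀ i i' : Fin (n + 1), (i' : ℕ) = i + 1 → e i = q * e i') (i : Fin (n + 1)) :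
    e i = q ^ (n - i) * e (Fin.last n) := by
  induction i using Fin.reverseInduction with
  | last => simp
  | cast i ih =>
    rw [h i.castSucc i.succ (by simp), ih, ← mul_assoc, ← pow_succ']
    congr 2
    simp only [Fin.val_succ, Fin.val_castSucc]
    omega

theorem sum_eq_geom_mul_last {n : ℕ} (q : ℝ≥0∞) {e : Fin (n + 1) → ℝ≥0∞}
    (h : ∀ i i' : Fin (n + 1), (i' : ℕ) = i + 1 → e i = q * e i') :
    ∑ i, e i = (∑ k ∈ Finset.range (n + 1), q ^ k) * e (Fin.last n) := by
  rw [Finset.sum_congr rfl fun i _ => eq_pow_mul_last q h i, ← Finset.sum_mul,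
    ← Finset.sum_range_reflect, Finset.sum_range]
  congr 1

/-- The distribution of the removable boxes over the rows. -/
theorem geom_mul_sum_levelGF_row (q : ℝ≥0∞) (a b : ℕ) (i : Fin (a + 1)) :
    (∑ k ∈ Finset.range (a + 1 + (b + 1)), q ^ k) *
      ∑ j : Fin (b + 1), levelGF q (fun I : Set (Box (a + 1) (b + 1)) => Maximal (· ∈ I) (i, j)) =
      q ^ (a - i) * (∑ k ∈ Finset.range (b + 1), q ^ k) *
        levelGF q fun _ : Set (Box (a + 1) (b + 1)) => True := by
  set e : Fin (a + 1) → ℝ≥0∞ := fun i => ∑ j : Fin (b + 1),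
    levelGF q (fun I : Set (Box (a + 1) (b + 1)) => Maximal (· ∈ I) (i, j)) with he
  set f : Fin (b + 1) → ℝ≥0∞ := fun j => ∑ i : Fin (a + 1),
    levelGF q (fun I : Set (Box (a + 1) (b + 1)) => Maximal (· ∈ I) (i, j)) with hf
  have h1 : ∀ i i' : Fin (a + 1), (i' : ℕ) = i + 1 → e i = q * e i' :=
    fun i i' h => sum_levelGF_row q h
  have h2 : ∀ j j' : Fin (b + 1), (j' : ℕ) = j + 1 → f j = q * f j' :=
    fun j j' h => sum_levelGF_column q h
  have h3 : q * e 0 + f (Fin.last b) = levelGF q fun _ : Set (Box (a + 1) (b + 1)) => True :=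
    firstRow_add_lastColumn q a b
  have h4 : ∑ i, e i = ∑ j, f j := Finset.sum_comm
  rw [sum_eq_geom_mul_last q h1, sum_eq_geom_mul_last q h2] at h4
  change _ * e i = _
  rw [eq_pow_mul_last q h1 i, ← h3, eq_pow_mul_last q h1 0, Finset.sum_range_add]
  simp only [pow_add q (a + 1), ← Finset.mul_sum, Fin.val_zero, Nat.sub_zero]
  generalize ∑ k ∈ Finset.range (a + 1), q ^ k = A at h4 ⊢
  generalize ∑ k ∈ Finset.range (b + 1), q ^ k = B at h4 ⊢
  calc (A + q ^ (a + 1) * B) * (q ^ (a - i) * e (Fin.last a))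
      = q ^ (a - i) * (A * e (Fin.last a) + q ^ (a + 1) * B * e (Fin.last a)) := by ring
    _ = q ^ (a - i) * B * (q * (q ^ a * e (Fin.last a)) + f (Fin.last b)) := by rw [h4]; ring

/-! ### Tableaux as permutations -/

/-- The row reading order of the boxes. -/
def label {a b : ℕ} : Box a b ≃ Fin (a * b) := finProdFinEquiv

theorem label_lt_iff {a b : ℕ} {u v : Box a b} :
    label u < label v ↔ u.1 < v.1 ∨ u.1 = v.1 ∧ u.2 < v.2 := by
  have key : ∀ u v : Box a b, u.1 < v.1 → label u < label v := by
    intro u v h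
    rw [Fin.lt_def] at h ⊢
    simp only [label, finProdFinEquiv_apply_val]
    have h1 : b * ((u.1 : ℕ) + 1) ≤ b * v.1 := Nat.mul_le_mul_left _ h
    have := u.2.2
    rw [mul_add] at h1
    omega
  rcases lt_trichotomy u.1 v.1 with h | h | h
  · simp [key u v h, h]
  · simp only [h, lt_irrefl, true_and, false_or]
    rw [Fin.lt_def, Fin.lt_def]
    simp only [label, finProdFinEquiv_apply_val, h]
    omega
  · simp [(key v u h).asymm, h.asymm, h.ne']

theorem label_strictMono {a b : ℕ} {u v : Box a b} (h : u < v) : label u < label v := by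
  rw [label_lt_iff]
  rcases h.le.1.lt_or_eq with h1 | h1
  · exact Or.inl h1
  · refine Or.inr ⟨h1, lt_of_le_of_ne h.le.2 fun h2 => h.ne (Prod.ext h1 h2)⟩

theorem label_lt_iff_row_lt {a b : ℕ} {u v : Box a b} (h : ¬ u < v) :
    label u < label v ↔ row u < row v := by
  rw [label_lt_iff, row, row]
  constructor
  · rintro (h1 | ⟨h1, h2⟩)
    · have := Fin.lt_def.1 h1
      omega
    · exact absurd (Prod.lt_iff.2 (Or.inr ⟨h1.le, h2⟩)) h
  · intro h1
    exact Or.inl (Fin.lt_def.2 (by omega))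

/-- The set `D` of descents counts entries from `1`, the permutation counts positions from `0`.
Whether `n` belongs to `D` does not matter, as it would contribute `n - n = 0`. -/
theorem sum_eq_permComaj {n : ℕ} (e : Equiv.Perm (Fin n)) {D : Finset ℕ} (hD : D ⊆ Finset.Icc 1 n)
    (h : ∀ (i : ℕ) (hi : i + 1 < n), i + 1 ∈ D ↔ e ⟨i + 1, hi⟩ < e ⟨i, by omega⟩) :
    ∑ i ∈ D, (n - i) = permComaj e := by
  have h1 : ∑ i ∈ D, (n - i) = ∑ i ∈ Finset.Icc 1 n, if i ∈ D then n - i else 0 := by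
    rw [← Finset.sum_filter, Finset.filter_mem_eq_inter, Finset.inter_eq_right.2 hD]
  rw [h1, ← Finset.Ico_add_one_right_eq_Icc, Finset.sum_Ico_eq_sum_range, permComaj]
  refine Finset.sum_congr (by simp) fun i _ => ?_
  rw [add_comm 1 i, permDes]
  by_cases hi : i + 1 < n
  · simp only [hi, dif_pos, h i hi]
    split_ifs <;> omega
  · simp only [hi, dif_neg, not_false_eq_true, zero_mul]
    split_ifs <;> omega

/-- The one-line permutation `e` lists the boxes along a linear extension of the rectangle. -/
def IsExt {a b : ℕ} (e : Equiv.Perm (Fin (a * b))) : Prop :=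
  ∀ u v : Box a b, u < v → e.symm (label u) < e.symm (label v)

/-- The tableau that numbers the boxes in the order in which `e` lists them. -/
def toTableau {a b : ℕ} (e : Equiv.Perm (Fin (a * b))) (u : Box a b) : ℕ :=
  e.symm (label u) + 1

theorem toTableau_injective {a b : ℕ} :
    Function.Injective (toTableau : Equiv.Perm (Fin (a * b)) → Box a b → ℕ) := by
  intro e e' h
  refine Equiv.symm_bijective.injective (Equiv.ext fun x => Fin.ext ?_)
  have := congrFun h (label.symm x)
  simpa [toTableau] using this

theorem isSYT_toTableau {a b : ℕ} {e : Equiv.Perm (Fin (a * b))} (he : IsExt e) :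
    IsSYT (toTableau e) := by
  refine ⟨⟨fun u _ => ?_, fun u _ v _ h => ?_, fun x hx => ?_⟩, fun i j j' h => ?_,
    fun i i' j h => ?_⟩
  · have := (e.symm (label u)).2
    simp only [toTableau, Set.mem_Icc]
    omega
  · simp only [toTableau, add_left_inj, Fin.val_inj] at h
    exact label.injective (e.symm.injective h)
  · obtain ⟨h1, h2⟩ := hx
    refine ⟨label.symm (e ⟨x - 1, by omega⟩), trivial, ?_⟩
    simp only [toTableau, Equiv.apply_symm_apply, Equiv.symm_apply_apply]
    omega
  · have := Fin.lt_def.1 (he _ _ (Prod.mk_lt_mk_iff_right.2 h : (i, j) < (i, j')))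
    simp only [toTableau]
    omega
  · have := Fin.lt_def.1 (he _ _ (Prod.mk_lt_mk_iff_left.2 h : (i, j) < (i', j)))
    simp only [toTableau]
    omega

theorem IsSYT.lt_of_lt {a b : ℕ} {T : Box a b → ℕ} (hT : IsSYT T) {u v : Box a b} (h : u < v) :
    T u < T v := by
  obtain ⟨i, j⟩ := u
  obtain ⟨i', j'⟩ := v
  obtain ⟨h1, h2⟩ := Prod.mk_le_mk.1 h.le
  rcases h1.lt_or_eq with hi | rfl
  · rcases h2.lt_or_eq with hj | rfl
    · exact (hT.2.1 i j j' hj).trans (hT.2.2 i i' j' hi)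
    · exact hT.2.2 i i' j hi
  · exact hT.2.1 i j j' (Prod.mk_lt_mk_iff_right.1 h)

theorem exists_isExt_toTableau {a b : ℕ} {T : Box a b → ℕ} (hT : IsSYT T) :
    ∃ e : Equiv.Perm (Fin (a * b)), IsExt e ∧ toTableau e = T := by
  have hm : ∀ u, 1 ≤ T u ∧ T u ≤ a * b := fun u => hT.1.mapsTo (Set.mem_univ u)
  let g : Fin (a * b) → Fin (a * b) := fun x =>
    ⟨T (label.symm x) - 1, by have := hm (label.symm x); omega⟩
  have hg : Function.Injective g := by
    intro x y h
    have h1 := Fin.mk.inj h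
    have hx := hm (label.symm x)
    have hy := hm (label.symm y)
    exact label.symm.injective
      (hT.1.injOn (Set.mem_univ _) (Set.mem_univ _) (by omega))
  let e := (Equiv.ofBijective g (Finite.injective_iff_bijective.1 hg)).symm
  have he : ∀ u, (e.symm (label u) : ℕ) = T u - 1 := fun u => by
    simp [e, g]
  refine ⟨e, fun u v h => ?_, funext fun u => ?_⟩
  · rw [Fin.lt_def, he, he]
    have := hT.lt_of_lt h
    have := hm u
    omega
  · rw [toTableau, he]
    have := hm u
    omega

theorem comaj_toTableau {a b : ℕ} {e : Equiv.Perm (Fin (a * b))} (he : IsExt e) :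
    comaj (toTableau e) = permComaj e := by
  classical
  refine sum_eq_permComaj e (Finset.filter_subset _ _) fun i hi => ?_
  obtain ⟨u, hu⟩ := label.surjective (e ⟨i, by omega⟩)
  obtain ⟨v, hv⟩ := label.surjective (e ⟨i + 1, hi⟩)
  have hu' : ∀ w, toTableau e w = i + 1 ↔ w = u := fun w => by
    rw [toTableau, add_left_inj, ← label.apply_eq_iff_eq, hu, ← Equiv.symm_apply_eq, Fin.ext_iff]
  have hv' : ∀ w, toTableau e w = i + 1 + 1 ↔ w = v := fun w => by
    rw [toTableau, add_left_inj, ← label.apply_eq_iff_eq, hv, ← Equiv.symm_apply_eq, Fin.ext_iff]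
  rw [← hu, ← hv, label_lt_iff_row_lt]
  · simp only [des, Finset.mem_filter, Finset.mem_Icc, hu', hv']
    constructor
    · rintro ⟨-, _, _, rfl, rfl, h⟩
      exact h
    · exact fun h => ⟨by omega, u, v, rfl, rfl, h⟩
  · intro h
    have := Fin.lt_def.1 (he _ _ h)
    rw [hu, hv] at this
    simp at this

open Classical in
theorem sum_SYT {R : Type*} [CommSemiring R] (q : R) (a b : ℕ) :
    ∑ T ∈ SYT a b, q ^ comaj T =
      ∑ e : Equiv.Perm (Fin (a * b)) with IsExt (a := a) (b := b) e, q ^ permComaj e := by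
  symm
  refine Finset.sum_bij (fun e _ => toTableau e) (fun e he => ?_) (fun _ _ _ _ h =>
    toTableau_injective h) (fun T hT => ?_) fun e he => ?_
  · exact mem_SYT.2 (isSYT_toTableau (Finset.mem_filter.1 he).2)
  · obtain ⟨e, he, rfl⟩ := exists_isExt_toTableau (mem_SYT.1 hT)
    exact ⟨e, by simpa using he, rfl⟩
  · rw [comaj_toTableau (Finset.mem_filter.1 he).2]

open Classical in
theorem tsum_monotone (q : ℝ≥0∞) (a b : ℕ) :
    ∑' π : Box a b → ℕ, (if Monotone π then q ^ (∑ u, π u) else 0) =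
      chainGF q (a * b) * ∑ T ∈ SYT a b, q ^ comaj T := by
  rw [sum_SYT, ← tsum_sort, ← (label.arrowCongr (Equiv.refl ℕ)).tsum_eq]
  refine tsum_congr fun π => if_congr ?_ ?_ rfl
  · simp only [IsExt, sort_symm_lt_iff, Equiv.arrowCongr_apply, Function.comp,
      Equiv.symm_apply_apply, Equiv.refl_apply]
    constructor
    · intro h u v huv
      have := h huv.le
      rcases this.lt_or_eq with h1 | h1
      · exact Or.inl h1
      · exact Or.inr ⟨h1, label_strictMono huv⟩
    · intro h u v huv
      rcases huv.lt_or_eq with h1 | rfl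
      · rcases h u v h1 with h2 | h2
        · exact h2.le
        · exact h2.1.le
      · rfl
  · rw [← label.sum_comp]
    simp

/-! ### Barely set-valued tableaux as permutations -/

/-- The position at which `e` lists the box `u`; the boxes are labelled `0, …, ab - 1` in row
reading order, and the label `ab` stands for the additional entry. -/
def pos {a b : ℕ} (e : Equiv.Perm (Fin (a * b + 1))) (u : Box a b) : Fin (a * b + 1) :=
  e.symm (label u).castSucc

/-- The position of the additional entry. -/
def posExtra {a b : ℕ} (e : Equiv.Perm (Fin (a * b + 1))) : Fin (a * b + 1) :=
  e.symm (Fin.last (a * b))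

/-- `e` lists the boxes along a linear extension, and the additional entry after `p` but before all
boxes southeast of `p`. -/
def IsExtAt {a b : ℕ} (p : Box a b) (e : Equiv.Perm (Fin (a * b + 1))) : Prop :=
  (∀ u v : Box a b, u < v → pos e u < pos e v) ∧ pos e p < posExtra (a := a) (b := b) e ∧
    ∀ v, p < v → posExtra (a := a) (b := b) e < pos e v

open Classical in
/-- The set-valued filling that numbers the entries in the order in which `e` lists them, the
additional entry being placed into the box `p`. -/
def toSetValued {a b : ℕ} (p : Box a b) (e : Equiv.Perm (Fin (a * b + 1))) (u : Box a b) :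
    Finset ℕ :=
  {(pos e u : ℕ) + 1} ∪ if u = p then {(posExtra (a := a) (b := b) e : ℕ) + 1} else ∅

section

variable {a b : ℕ} {p : Box a b} {e : Equiv.Perm (Fin (a * b + 1))}

theorem mem_toSetValued {u : Box a b} {x : ℕ} : x ∈ toSetValued p e u ↔
    x = pos e u + 1 ∨ u = p ∧ x = posExtra (a := a) (b := b) e + 1 := by
  rw [toSetValued]
  split_ifs with h <;> simp [h]

theorem pos_injective : Function.Injective (pos e : Box a b → _) := fun _ _ h =>
  label.injective (Fin.castSucc_injective _ (e.symm.injective h))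

theorem pos_ne_posExtra (u : Box a b) : pos e u ≠ posExtra (a := a) (b := b) e := fun h =>
  (Fin.castSucc_lt_last (label u)).ne (e.symm.injective h)

theorem eq_posExtra_or_eq_pos (x : Fin (a * b + 1)) :
    x = posExtra (a := a) (b := b) e ∨ ∃ u : Box a b, x = pos e u := by
  rcases Fin.eq_castSucc_or_eq_last (e x) with ⟨y, hy⟩ | h
  · refine Or.inr ⟨label.symm y, ?_⟩
    rw [pos, Equiv.apply_symm_apply, ← hy, Equiv.symm_apply_apply]
  · refine Or.inl ?_
    rw [posExtra, ← h, Equiv.symm_apply_apply]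

theorem isBarelySetValuedSYT_toSetValued (h : IsExtAt p e) :
    IsBarelySetValuedSYT (toSetValued p e) := by
  obtain ⟨h1, h2, h3⟩ := h
  refine ⟨fun u => ⟨_, mem_toSetValued.2 (Or.inl rfl)⟩, ?_, fun u v huv => ?_,
    fun u v huv x hx y hy => ?_⟩
  · ext x
    simp only [Finset.mem_biUnion, Finset.mem_univ, true_and, mem_toSetValued, Finset.mem_Icc]
    constructor
    · rintro ⟨u, rfl | ⟨-, rfl⟩⟩
      · have := (pos e u).2
        omega
      · have := (posExtra (a := a) (b := b) e).2
        omega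
    · rintro ⟨hx1, hx2⟩
      rcases eq_posExtra_or_eq_pos (e := e) (a := a) (b := b) ⟨x - 1, by omega⟩ with h | ⟨u, h⟩
      · have := Fin.ext_iff.1 h
        simp only at this
        exact ⟨p, Or.inr ⟨rfl, by omega⟩⟩
      · have := Fin.ext_iff.1 h
        simp only at this
        exact ⟨u, Or.inl (by omega)⟩
  · rw [Finset.disjoint_left]
    intro x hx hy
    rw [mem_toSetValued] at hx hy
    have h4 := fun h => huv (pos_injective (e := e) (Fin.ext h))
    have h5 := fun h => pos_ne_posExtra (e := e) u (Fin.ext h)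
    have h6 := fun h => pos_ne_posExtra (e := e) v (Fin.ext h)
    rcases hx with rfl | ⟨rfl, rfl⟩
    · rcases hy with hy | ⟨-, hy⟩
      · exact h4 (by omega)
      · exact h5 (by omega)
    · rcases hy with hy | ⟨rfl, -⟩
      · exact h6 (by omega)
      · exact huv rfl
  · rw [mem_toSetValued] at hx hy
    have h4 := Fin.lt_def.1 (h1 u v huv)
    rcases hx with rfl | ⟨rfl, rfl⟩
    · rcases hy with rfl | ⟨rfl, rfl⟩
      · omega
      · have := Fin.lt_def.1 h2
        omega
    · have := Fin.lt_def.1 (h3 v huv)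
      rcases hy with rfl | ⟨rfl, rfl⟩
      · omega
      · exact absurd huv (lt_irrefl _)

theorem doubled_toSetValued : doubled (toSetValued p e) = {p} := by
  ext u
  rw [doubled, Finset.mem_filter, Finset.mem_singleton, and_iff_right (Finset.mem_univ u),
    toSetValued]
  split_ifs with h
  · refine iff_of_true (Finset.card_pair fun h' => ?_) h
    exact pos_ne_posExtra (e := e) u (Fin.ext (by omega))
  · simp [h]

theorem rStar_toSetValued : rStar (toSetValued p e) = row p := by
  rw [rStar, doubled_toSetValued, Finset.sup_singleton]

theorem iStar_toSetValued (h : IsExtAt p e) :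
    iStar (toSetValued p e) = posExtra (a := a) (b := b) e + 1 := by
  have := Fin.lt_def.1 h.2.1
  rw [iStar, doubled_toSetValued, Finset.sup_singleton, toSetValued, if_pos rfl, Finset.sup_union]
  simp only [Finset.sup_singleton, id]
  exact max_eq_right (by omega)

theorem comajPlus_toSetValued (h : IsExtAt p e) :
    comajPlus (toSetValued p e) = permComaj e := by
  classical
  refine sum_eq_permComaj e (Finset.filter_subset _ _) fun i hi => ?_
  simp only [desPlus, Finset.mem_filter, Finset.mem_Icc, iStar_toSetValued h]
  have hpos : ∀ (i : ℕ) (hi : i < a * b + 1) (w : Box a b),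
      (⟨i, hi⟩ : Fin _) = pos e w ↔ e ⟨i, hi⟩ = (label w).castSucc := fun i hi w => by
    rw [pos, Equiv.eq_symm_apply]
  -- the additional entry has the largest label: no descent leads to it, one always starts there
  rcases eq_posExtra_or_eq_pos (e := e) (a := a) (b := b) ⟨i + 1, hi⟩ with hv | ⟨v, hv⟩
  · have h1 := congrArg Fin.val hv
    refine iff_of_false (fun h => h.2.1 (by simp only at h1; omega)) ?_
    rw [hv, posExtra, Equiv.apply_symm_apply]
    exact (Fin.le_last _).not_gt
  rcases eq_posExtra_or_eq_pos (e := e) (a := a) (b := b) ⟨i, by omega⟩ with hu | ⟨u, hu⟩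
  · have h1 := congrArg Fin.val hu
    simp only at h1
    refine iff_of_true ⟨by omega, by omega, Or.inl (by omega)⟩ ?_
    rw [hu, posExtra, Equiv.apply_symm_apply, (hpos _ _ _).1 hv]
    exact Fin.castSucc_lt_last _
  have hk1 : i + 1 ≠ posExtra (a := a) (b := b) e := fun hh =>
    pos_ne_posExtra v (hv.symm.trans (Fin.ext hh))
  have hk0 : i ≠ posExtra (a := a) (b := b) e := fun hh =>
    pos_ne_posExtra u (hu.symm.trans (Fin.ext hh))
  have hu' : ∀ w, i + 1 ∈ toSetValued p e w ↔ w = u := fun w => by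
    rw [mem_toSetValued, ← (pos_injective (e := e)).eq_iff (a := w) (b := u), ← hu, Fin.ext_iff]
    simp only
    omega
  have hv' : ∀ w, i + 1 + 1 ∈ toSetValued p e w ↔ w = v := fun w => by
    rw [mem_toSetValued, ← (pos_injective (e := e)).eq_iff (a := w) (b := v), ← hv, Fin.ext_iff]
    simp only
    omega
  rw [(hpos _ _ _).1 hv, (hpos _ _ _).1 hu, Fin.castSucc_lt_castSucc_iff, label_lt_iff_row_lt]
  · simp only [hu', hv']
    constructor
    · rintro ⟨-, -, h | ⟨_, _, rfl, rfl, h⟩⟩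
      · omega
      · exact h
    · exact fun h => ⟨by omega, by omega, Or.inr ⟨u, v, rfl, rfl, h⟩⟩
  · intro hlt
    have := h.1 _ _ hlt
    rw [← hu, ← hv, Fin.lt_def] at this
    simp only at this
    omega

end

theorem toSetValued_injective {a b : ℕ} {p p' : Box a b} {e e' : Equiv.Perm (Fin (a * b + 1))}
    (h : IsExtAt p e) (h' : IsExtAt p' e') (heq : toSetValued p e = toSetValued p' e') :
    p = p' ∧ e = e' := by
  have h1 : p = p' := by
    have := congrArg doubled heq
    rwa [doubled_toSetValued, doubled_toSetValued, Finset.singleton_inj] at this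
  subst h1
  have h2 : posExtra (a := a) (b := b) e = posExtra (a := a) (b := b) e' := by
    have := congrArg iStar heq
    rw [iStar_toSetValued h, iStar_toSetValued h'] at this
    exact Fin.ext (by omega)
  refine ⟨rfl, Equiv.symm_bijective.injective (Equiv.ext fun x => ?_)⟩
  refine Fin.lastCases h2 (fun x => ?_) x
  obtain ⟨u, rfl⟩ := label.surjective x
  change pos e u = pos e' u
  have h3 : (pos e u : ℕ) + 1 ∈ toSetValued p e' u := heq ▸ mem_toSetValued.2 (Or.inl rfl)
  rcases mem_toSetValued.1 h3 with h4 | ⟨-, h4⟩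
  · exact Fin.ext (by omega)
  · exact absurd (h2.trans (Fin.ext (by omega)).symm) (pos_ne_posExtra u).symm

theorem exists_isExtAt_toSetValued {a b : ℕ} {S : Box a b → Finset ℕ}
    (hS : IsBarelySetValuedSYT S) :
    ∃ p e, IsExtAt p e ∧ toSetValued p e = S := by
  classical
  obtain ⟨p, hp, hne⟩ := existsUnique_doubled hS
  obtain ⟨-, hun, hdis, hlt⟩ := hS
  -- the smaller entry `m u` of each box and the larger entry `M` of the doubled box
  obtain ⟨m, M, hmM, hm⟩ : ∃ (m : Box a b → ℕ) (M : ℕ), m p < M ∧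
      ∀ u, S u = {m u} ∪ if u = p then {M} else ∅ := by
    obtain ⟨x, y, hxy, hSp⟩ := Finset.card_eq_two.1 hp
    choose! m hm using fun u hu => Finset.card_eq_one.1 (hne u hu)
    refine ⟨Function.update m p (min x y), max x y, ?_, fun u => ?_⟩
    · simpa using min_lt_max.2 hxy
    · rcases eq_or_ne u p with rfl | hu
      · rw [hSp, Function.update_self, if_pos rfl]
        rcases le_total x y with h | h
        · rw [min_eq_left h, max_eq_right h]; rfl
        · rw [min_eq_right h, max_eq_left h, Finset.pair_comm]; rfl
      · simp [hu, hm u hu]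
  have hmem : ∀ u, m u ∈ S u := fun u => by simp [hm u]
  have hMem : M ∈ S p := by simp [hm p]
  have hIcc : ∀ u x, x ∈ S u → 1 ≤ x ∧ x ≤ a * b + 1 := fun u x hx => by
    rw [← Finset.mem_Icc, ← hun]
    exact Finset.mem_biUnion.2 ⟨u, Finset.mem_univ u, hx⟩
  have huniq : ∀ u v x, x ∈ S u → x ∈ S v → u = v := fun u v x hu hv => by
    by_contra h
    exact Finset.disjoint_left.1 (hdis u v h) hu hv
  let g₀ : Fin (a * b + 1) → ℕ := Fin.lastCases M fun x => m (label.symm x)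
  have hg₀ : ∀ x, 1 ≤ g₀ x ∧ g₀ x ≤ a * b + 1 := by
    refine Fin.lastCases ?_ fun x => ?_
    · simpa [g₀] using hIcc p M hMem
    · simpa [g₀] using hIcc _ _ (hmem (label.symm x))
  have hne' : ∀ u, m u ≠ M := fun u h => by
    have := huniq u p M (h ▸ hmem u) hMem
    subst this
    omega
  have hinj : Function.Injective g₀ := by
    intro x y
    refine Fin.lastCases ?_ (fun x => ?_) x <;> refine Fin.lastCases ?_ (fun y => ?_) y
    · simp
    · simpa [g₀] using fun h => (hne' _ h.symm).elim
    · simpa [g₀] using fun h => (hne' _ h).elim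
    · simp only [g₀, Fin.lastCases_castSucc]
      intro h
      exact congrArg _ (label.symm.injective (huniq _ _ _ (h ▸ hmem _) (hmem (label.symm y))))
  let g : Fin (a * b + 1) → Fin (a * b + 1) := fun x => ⟨g₀ x - 1, by have := hg₀ x; omega⟩
  have hg : Function.Injective g := by
    intro x y h
    have h1 := Fin.mk.inj h
    have := hg₀ x
    have := hg₀ y
    exact hinj (by omega)
  let e := (Equiv.ofBijective g (Finite.injective_iff_bijective.1 hg)).symm
  have he : ∀ u, (pos e u : ℕ) + 1 = m u := fun u => by
    have := (hIcc u _ (hmem u)).1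
    simp only [pos, e, g, g₀, Equiv.symm_symm, Equiv.ofBijective_apply, Fin.lastCases_castSucc,
      Equiv.symm_apply_apply]
    omega
  have hk : (posExtra (a := a) (b := b) e : ℕ) + 1 = M := by
    have := (hIcc p _ hMem).1
    simp only [posExtra, e, g, g₀, Equiv.symm_symm, Equiv.ofBijective_apply, Fin.lastCases_last]
    omega
  refine ⟨p, e, ⟨fun u v h => ?_, ?_, fun v h => ?_⟩, funext fun u => ?_⟩
  · have := hlt u v h _ (hmem u) _ (hmem v)
    have := he u
    have := he v
    exact Fin.lt_def.2 (by omega)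
  · have := he p
    exact Fin.lt_def.2 (by omega)
  · have := hlt p v h _ hMem _ (hmem v)
    have := he v
    exact Fin.lt_def.2 (by omega)
  · rw [toSetValued, he, hk, hm u]

open Classical in
/-- The generating function of barely set-valued tableaux whose doubled box is `p`, in terms of
permutations. -/
noncomputable def doubledSum {R : Type*} [CommSemiring R] (q : R) {a b : ℕ} (p : Box a b) : R :=
  ∑ e with IsExtAt p e, q ^ permComaj e

theorem sum_BSVSYT {R : Type*} [CommSemiring R] (q t : R) (a b : ℕ) :
    ∑ S ∈ BSVSYT a b, q ^ comajPlus S * t ^ (rStar S - 1) =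
      ∑ i : Fin a, t ^ (i : ℕ) * ∑ j : Fin b, doubledSum q (i, j) := by
  classical
  have h : ∑ i : Fin a, t ^ (i : ℕ) * ∑ j : Fin b, doubledSum q (i, j) =
      ∑ x : Box a b × Equiv.Perm (Fin (a * b + 1)) with IsExtAt x.1 x.2,
        q ^ permComaj x.2 * t ^ (row x.1 - 1) := by
    rw [Finset.sum_filter, Fintype.sum_prod_type, Fintype.sum_prod_type]
    refine Finset.sum_congr rfl fun i _ => ?_
    rw [Finset.mul_sum]
    refine Finset.sum_congr rfl fun j _ => ?_
    rw [doubledSum, Finset.mul_sum, Finset.sum_filter]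
    refine Finset.sum_congr rfl fun e _ => ?_
    simp only [row, Nat.add_sub_cancel, mul_comm]
  rw [h]
  symm
  refine Finset.sum_bij (fun x _ => toSetValued x.1 x.2) (fun x hx => ?_) (fun x hx y hy h => ?_)
    (fun S hS => ?_) fun x hx => ?_
  · exact mem_BSVSYT.2 (isBarelySetValuedSYT_toSetValued (Finset.mem_filter.1 hx).2)
  · have := toSetValued_injective (Finset.mem_filter.1 hx).2 (Finset.mem_filter.1 hy).2 h
    exact Prod.ext this.1 this.2
  · obtain ⟨p, e, he, rfl⟩ := exists_isExtAt_toSetValued (mem_BSVSYT.1 hS)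
    exact ⟨(p, e), by simpa using he, rfl⟩
  · rw [comajPlus_toSetValued (Finset.mem_filter.1 hx).2, rStar_toSetValued]

/-- The additional entry has the largest label, so ties put it after the boxes with the same
value: this is what makes "removable box of the level set" a condition on the sorting permutation. -/
theorem levelGF_maximal (q : ℝ≥0∞) {a b : ℕ} (p : Box a b) :
    levelGF q (fun I => Maximal (· ∈ I) p) = chainGF q (a * b + 1) * doubledSum q p := by
  classical
  rw [doubledSum, ← tsum_sort, levelGF,
    ← (((Equiv.refl ℕ).prodCongr (label.arrowCongr (Equiv.refl ℕ))).trans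
      (Fin.snocEquiv fun _ => ℕ)).tsum_eq]
  refine tsum_congr fun x => if_congr ?_ ?_ rfl
  · obtain ⟨k, π⟩ := x
    simp only [IsExtAt, pos, posExtra, sort_symm_lt_iff, Equiv.trans_apply, Equiv.prodCongr_apply,
      Prod.map, Fin.snocEquiv_apply, Fin.snoc_castSucc, Fin.snoc_last, Equiv.arrowCongr_apply,
      Function.comp, Equiv.symm_apply_apply, Equiv.refl_apply, Fin.castSucc_lt_castSucc_iff,
      Fin.castSucc_lt_last, and_true, (Fin.castSucc_lt_last _).asymm, and_false, or_false,
      maximal_iff_forall_gt, level, Set.mem_ofPred_eq, not_le]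
    rw [← le_iff_lt_or_eq]
    refine and_congr_left fun _ => ⟨fun h u v huv => ?_, fun h u v huv => ?_⟩
    · rcases (h huv.le).lt_or_eq with h1 | h1
      · exact Or.inl h1
      · exact Or.inr ⟨h1, label_strictMono huv⟩
    · rcases huv.lt_or_eq with h1 | rfl
      · rcases h u v h1 with h2 | h2
        · exact h2.le
        · exact h2.1.le
      · rfl
  · rw [Fin.sum_univ_castSucc, ← label.sum_comp]
    simp [add_comm]

theorem levelGF_true (q : ℝ≥0∞) (a b : ℕ) :
    levelGF q (fun _ : Set (Box a b) => True) =
      (1 - q)⁻¹ * (chainGF q (a * b) * ∑ T ∈ SYT a b, q ^ comaj T) := by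
  classical
  rw [levelGF, ENNReal.tsum_prod', ← tsum_monotone, ← ENNReal.tsum_geometric,
    ← ENNReal.tsum_mul_right]
  refine tsum_congr fun k => ?_
  rw [← ENNReal.tsum_mul_left]
  refine tsum_congr fun π => ?_
  simp [pow_add]

/-! ### From real parameters to arbitrary fields -/

theorem inv_one_sub_eq {r : NNReal} (hr : r < 1) {n : ℕ} (hn : n ≠ 0) :
    (1 - (r : ℝ≥0∞))⁻¹ =
      (∑ k ∈ Finset.range n, (r : ℝ≥0∞) ^ k) * (1 - (r : ℝ≥0∞) ^ n)⁻¹ := by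
  have h1 : (∑ k ∈ Finset.range n, r ^ k) * (1 - r) = 1 - r ^ n := geom_sum_mul_of_le_one hr.le n
  have h2 : (∑ k ∈ Finset.range n, (r : ℝ≥0∞) ^ k) * (1 - r) = 1 - (r : ℝ≥0∞) ^ n := by
    exact_mod_cast congrArg ((↑) : NNReal → ℝ≥0∞) h1
  have hr' : (r : ℝ≥0∞) < 1 := by exact_mod_cast hr
  have h3 : (1 - (r : ℝ≥0∞)) ≠ 0 := (tsub_pos_of_lt hr').ne'
  have h4 : (1 - (r : ℝ≥0∞) ^ n) ≠ 0 := (tsub_pos_of_lt (pow_lt_one₀ zero_le hr' hn)).ne'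
  have h5 : ∀ x : ℝ≥0∞, 1 - x ≠ ⊤ := fun x => ENNReal.sub_ne_top ENNReal.one_ne_top
  calc (1 - (r : ℝ≥0∞))⁻¹
      = (1 - (r : ℝ≥0∞))⁻¹ * ((1 - (r : ℝ≥0∞) ^ n) * (1 - (r : ℝ≥0∞) ^ n)⁻¹) := by
        rw [ENNReal.mul_inv_cancel h4 (h5 _), mul_one]
    _ = (1 - (r : ℝ≥0∞)) * (1 - (r : ℝ≥0∞))⁻¹ *
          ((∑ k ∈ Finset.range n, (r : ℝ≥0∞) ^ k) * (1 - (r : ℝ≥0∞) ^ n)⁻¹) := by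
        rw [← h2]; ring
    _ = _ := by rw [ENNReal.mul_inv_cancel h3 (h5 _), one_mul]

theorem geom_mul_sum_doubledSum_nnreal {r : NNReal} (hr : r < 1) (a b : ℕ) (i : Fin (a + 1)) :
    (∑ k ∈ Finset.range (a + 1 + (b + 1)), r ^ k) *
      ∑ j : Fin (b + 1), doubledSum r (i, j) =
      r ^ (a - i) * (∑ k ∈ Finset.range (b + 1), r ^ k) *
        (∑ k ∈ Finset.range ((a + 1) * (b + 1) + 1), r ^ k) *
        ∑ T ∈ SYT (a + 1) (b + 1), r ^ comaj T := by
  have hr' : (r : ℝ≥0∞) < 1 := by exact_mod_cast hr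
  have h := geom_mul_sum_levelGF_row (r : ℝ≥0∞) a b i
  simp_rw [levelGF_maximal, levelGF_true] at h
  rw [inv_one_sub_eq hr (Nat.succ_ne_zero ((a + 1) * (b + 1))), ← Finset.mul_sum] at h
  have h0 := chainGF_ne_zero (r : ℝ≥0∞) ((a + 1) * (b + 1) + 1)
  have h1 := chainGF_ne_top hr' ((a + 1) * (b + 1) + 1)
  have h2 : chainGF (r : ℝ≥0∞) ((a + 1) * (b + 1) + 1) *
      ((∑ k ∈ Finset.range (a + 1 + (b + 1)), (r : ℝ≥0∞) ^ k) *
        ∑ j : Fin (b + 1), doubledSum (r : ℝ≥0∞) (i, j)) =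
      chainGF (r : ℝ≥0∞) ((a + 1) * (b + 1) + 1) *
      ((r : ℝ≥0∞) ^ (a - i : ℕ) * (∑ k ∈ Finset.range (b + 1), (r : ℝ≥0∞) ^ k) *
        (∑ k ∈ Finset.range ((a + 1) * (b + 1) + 1), (r : ℝ≥0∞) ^ k) *
        ∑ T ∈ SYT (a + 1) (b + 1), (r : ℝ≥0∞) ^ comaj T) := by
    rw [mul_left_comm, h, chainGF_succ]
    ring
  have h3 := (ENNReal.mul_right_inj h0 h1).1 h2
  simp only [doubledSum] at h3 ⊢
  exact_mod_cast h3

open Polynomial in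
theorem eq_of_forall_lt_one_eval₂_eq {P Q : ℕ[X]} (h : ∀ r : NNReal, r < 1 →
    P.eval₂ (Nat.castRingHom NNReal) r = Q.eval₂ (Nat.castRingHom NNReal) r) : P = Q := by
  have hinj : Function.Injective (Nat.castRingHom ℝ) := Nat.cast_injective
  refine Polynomial.map_injective _ hinj (Polynomial.eq_of_infinite_eval_eq _ _ ?_)
  refine (Set.Ico_infinite (zero_lt_one' ℝ)).mono fun x hx => ?_
  obtain ⟨hx0, hx1⟩ := hx
  lift x to NNReal using hx0
  have key : ∀ P : ℕ[X], ((P.eval₂ (Nat.castRingHom NNReal) x : NNReal) : ℝ) =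
      (P.map (Nat.castRingHom ℝ)).eval (x : ℝ) := fun P => by
    rw [eval_map, eval₂_eq_sum_range, eval₂_eq_sum_range]
    push_cast
    simp
  change _ = _
  rw [← key, ← key, h x (by exact_mod_cast hx1)]

open Polynomial in
/-- The identity refined by the row of the doubled box, in an arbitrary commutative semiring. -/
theorem geom_mul_sum_doubledSum {R : Type*} [CommSemiring R] (q : R) (a b : ℕ) (i : Fin (a + 1)) :
    (∑ k ∈ Finset.range (a + 1 + (b + 1)), q ^ k) *
      ∑ j : Fin (b + 1), doubledSum q (i, j) =
      q ^ (a - i) * (∑ k ∈ Finset.range (b + 1), q ^ k) *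
        (∑ k ∈ Finset.range ((a + 1) * (b + 1) + 1), q ^ k) *
        ∑ T ∈ SYT (a + 1) (b + 1), q ^ comaj T := by
  have h : (∑ k ∈ Finset.range (a + 1 + (b + 1)), (X : ℕ[X]) ^ k) *
      ∑ j : Fin (b + 1), doubledSum (X : ℕ[X]) (i, j) =
      X ^ (a - i) * (∑ k ∈ Finset.range (b + 1), X ^ k) *
        (∑ k ∈ Finset.range ((a + 1) * (b + 1) + 1), X ^ k) *
        ∑ T ∈ SYT (a + 1) (b + 1), X ^ comaj T := by
    refine eq_of_forall_lt_one_eval₂_eq fun r hr => ?_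
    have := geom_mul_sum_doubledSum_nnreal hr a b i
    simpa only [doubledSum, eval₂_mul, eval₂_finsetSum, eval₂_X_pow] using this
  have := congrArg (eval₂ (Nat.castRingHom R) q) h
  simpa only [doubledSum, eval₂_mul, eval₂_finsetSum, eval₂_X_pow] using this

end RectTableau

theorem mainTheorem3 {K : Type*} [Field K] (q t : K) (a b : ℕ) (ha : 1 ≤ a) (hb : 1 ≤ b)
    (hq : RectTableau.qNum q (a + b) ≠ 0) :
    ∑ S ∈ RectTableau.BSVSYT a b, q ^ RectTableau.comajPlus S * t ^ (RectTableau.rStar S - 1) =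
      RectTableau.qtNum q t a * RectTableau.qNum q b / RectTableau.qNum q (a + b) *
        RectTableau.qNum q (a * b + 1) *
        ∑ T ∈ RectTableau.SYT a b, q ^ RectTableau.comaj T := by
  obtain ⟨a, rfl⟩ : ∃ a', a = a' + 1 := ⟨a - 1, by omega⟩
  obtain ⟨b, rfl⟩ : ∃ b', b = b' + 1 := ⟨b - 1, by omega⟩
  rw [div_mul_eq_mul_div, div_mul_eq_mul_div, eq_div_iff hq, RectTableau.sum_BSVSYT,
    RectTableau.qtNum, ← Finset.sum_range_reflect, Finset.sum_range, Finset.sum_mul,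
    Finset.sum_mul, Finset.sum_mul, Finset.sum_mul]
  refine Finset.sum_congr rfl fun i _ => ?_
  have h := RectTableau.geom_mul_sum_doubledSum q a b i
  have hi : a + 1 - 1 - (a + 1 - 1 - (i : ℕ)) = i := by omega
  have hi' : a + 1 - 1 - (i : ℕ) = a - i := by omega
  rw [hi, hi', mul_assoc, mul_comm (∑ j : Fin (b + 1), _), RectTableau.qNum, h,
    RectTableau.qNum, RectTableau.qNum]
  ring
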